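/- Let $M\ge 1$, $\Gamma\ge 0$, $\Lambda\ge 0$, and let $\Sigma_W$ be a positive definite $M\times M$ real covariance matrix with eigenvalues (noise variances) $\sigma_1^2\le\sigma_2^2\le\dots\le\sigma_M^2$, counted with multiplicity (so $\Sigma_W=\operatorname{diag}(\sigma_1^2,\dots,\sigma_M^2)$ is a special case). Over blocklength $n$, the $(M,M,1)$ MIMO arbitrarily varying channel (AVC) is $$\mathbf Y=\mathbf X+\mathbf s\,\mathbf g^{T}+\mathbf W,\qquad \mathbf X,\mathbf Y,\mathbf W\in\mathbb R^{n\times M},$$ where the rows of $\mathbf W$ are i.i.d. $\mathcal N(0,\Sigma_W)$, and the jammer chooses any $\mathbf s\in\mathbb R^n$ with $\|\mathbf s\|^2\le n\Lambda$ and any unit vector $\mathbf g\in\mathbb R^M$. An $(n,N)$ deterministic code is a pair $\phi:[N]\to\mathbb R^{n\times M}$, $\psi:\mathbb R^{n\times M}\to[N]$ with $\|\phi(i)\|^2\le n\Gamma$ (Frobenius norm) for all $i$; an $(n,N)$ randomized code is a random variable $(\Phi,\Psi)$, independent of $\mathbf W$, with values in the $(n,N)$ deterministic codes, and its maximal error probability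 is $$\varepsilon=\sup_{\mathbf s:\|\mathbf s\|^2\le n\Lambda}\ \sup_{\mathbf g:\|\mathbf g\|=1}\ \max_{i\in[N]}\ \mathbb P\bigl(\Psi(\Phi(i)+\mathbf s\,\mathbf g^{T}+\mathbf W)\ne i\bigr).$$ A rate $R$ is achievable if there is a sequence of $(n,\lceil \exp(nR)\rceil)$ randomized codes whose maximal error probability tends to $0$ as $n\to\infty$. The capacity $C_r$ is the supremum of the achievable rates. Theorem. Put $\tau_1=\sigma_1^2+\Lambda$ and $\tau_m=\sigma_m^2$ for $2\le m\le M$. Then the maximum $$\gamma^*=\max\Bigl\{\gamma\in\mathbb R:\ \sum_{m=1}^M(\gamma-\tau_m)^+\le\Gamma\Bigr\}$$ exists, and with $\Gamma_m=(\gamma^*-\tau_m)^+$ (where $x^+=\max(x,0)$) one has $$C_r\ \le\ R_{\mathrm{ub}}=\sum_{m=1}^M\frac12\log\Bigl(1+\frac{\Gamma_m}{\tau_m}\Bigr),$$ with natural logarithms. -/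

import Mathlib

open MeasureTheory ProbabilityTheory Filter Topology

noncomputable section

namespace MimoAVC

/-- `n × M` real matrices, stored as the tuple of their `n` rows (each with the Euclidean norm).
The squared Frobenius norm of `X` is `∑ t, ‖X t‖ ^ 2`. -/
abbrev Block (n M : ℕ) : Type := Fin n → EuclideanSpace ℝ (Fin M)

/-- An `(n, N)` deterministic code with power constraint `Γ` for an `M × M` channel. -/
structure DetCode (n N M : ℕ) (Γ : ℝ) where
  enc : Fin N → Block n M
  dec : Block n M → Fin N
  power_le : ∀ i, ∑ t, ‖enc i t‖ ^ 2 ≤ n * Γ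

/-- An `(n, N)` randomized code with power constraint `Γ`: a random variable, defined on a
probability space shared by the encoder and the decoder, with values in the `(n, N)` deterministic
codes. The measurability conditions make the error events events. -/
structure RandomizedCode (n N M : ℕ) (Γ : ℝ) where
  Ω : Type
  [measurableSpace : MeasurableSpace Ω]
  P : Measure Ω
  [isProbabilityMeasure : IsProbabilityMeasure P]
  code : Ω → DetCode n N M Γ
  measurable_enc : ∀ i, Measurable fun ω => (code ω).enc i
  measurable_dec : Measurable fun p : Ω × Block n M => (code p.1).dec p.2

attribute [instance] RandomizedCode.measurableSpace RandomizedCode.isProbabilityMeasure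

/-- The channel output `Y = X + s gᵀ + W`. -/
def channelOutput {n M : ℕ} (X : Block n M) (s : EuclideanSpace ℝ (Fin n))
    (g : EuclideanSpace ℝ (Fin M)) (W : Block n M) : Block n M :=
  fun t => X t + s t • g + W t

/-- The law of the noise `W`: the rows are i.i.d. `𝒩(0, S)`. -/
def noise (n : ℕ) {M : ℕ} (S : Matrix (Fin M) (Fin M) ℝ) : Measure (Block n M) :=
  Measure.pi fun _ : Fin n => multivariateGaussian 0 S

/-- `ℙ(Ψ(Φ(i) + s gᵀ + W) ≠ i)`, where `(Φ, Ψ)` is the randomized code and `W` is noise with row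
covariance `S`, independent of the code. -/
def errorProb {n N M : ℕ} {Γ : ℝ} (S : Matrix (Fin M) (Fin M) ℝ) (c : RandomizedCode n N M Γ)
    (s : EuclideanSpace ℝ (Fin n)) (g : EuclideanSpace ℝ (Fin M)) (i : Fin N) : ENNReal :=
  (c.P.prod (noise n S))
    {p | (c.code p.1).dec (channelOutput ((c.code p.1).enc i) s g p.2) ≠ i}

/-- The maximal error probability under a rank-one jammer with power `Λ`: the supremum over jamming
signals `s` with `‖s‖² ≤ n Λ`, unit vectors `g` and messages `i`. -/
def maxError {n N M : ℕ} {Γ : ℝ} (S : Matrix (Fin M) (Fin M) ℝ) (Λ : ℝ)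
    (c : RandomizedCode n N M Γ) : ENNReal :=
  ⨆ (s : EuclideanSpace ℝ (Fin n)) (_ : ‖s‖ ^ 2 ≤ n * Λ)
    (g : EuclideanSpace ℝ (Fin M)) (_ : ‖g‖ = 1) (i : Fin N), errorProb S c s g i

/-- `R` (in nats per channel use) is achievable under randomized coding and maximal error over the
`(M, M, 1)` MIMO AVC with input power `Γ`, jammer power `Λ` and noise covariance `S`. -/
def IsAchievable {M : ℕ} (S : Matrix (Fin M) (Fin M) ℝ) (Γ Λ R : ℝ) : Prop :=
  ∃ c : ∀ n : ℕ, RandomizedCode n ⌈Real.exp (n * R)⌉₊ M Γ,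
    Tendsto (fun n => maxError S Λ (c n)) atTop (𝓝 0)

/-- The randomized coding capacity: the supremum, in the extended reals, of the achievable rates. -/
def capacity {M : ℕ} (S : Matrix (Fin M) (Fin M) ℝ) (Γ Λ : ℝ) : EReal :=
  sSup ((fun R : ℝ => (R : EReal)) '' {R | IsAchievable S Γ Λ R})

/-- The noise spectrum `τ` obtained by adding `Λ` to the first entry of `σsq`. -/
def jammedSpectrum {M : ℕ} (σsq : Fin M → ℝ) (Λ : ℝ) : Fin M → ℝ :=
  fun m => if (m : ℕ) = 0 then σsq m + Λ else σsq m

/-- The water levels `γ` for the noise spectrum `τ` that need power at most `Γ`. -/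
def feasibleLevels {M : ℕ} (τ : Fin M → ℝ) (Γ : ℝ) : Set ℝ :=
  {γ | ∑ m, max (γ - τ m) 0 ≤ Γ}

/-- The water level `γ* = max {γ | ∑ m, (γ - τ m)⁺ ≤ Γ}`. -/
def waterLevel {M : ℕ} (τ : Fin M → ℝ) (Γ : ℝ) : ℝ :=
  sSup (feasibleLevels τ Γ)

/-- The waterfilling power allocation. -/
def waterPower {M : ℕ} (τ : Fin M → ℝ) (Γ : ℝ) : Fin M → ℝ :=
  fun m => max (waterLevel τ Γ - τ m) 0

/-- The waterfilling rate over parallel Gaussian channels with noise spectrum `τ`. -/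
def waterRate {M : ℕ} (τ : Fin M → ℝ) (Γ : ℝ) : ℝ :=
  ∑ m, 1 / 2 * Real.log (1 + waterPower τ Γ m / τ m)

end MimoAVC

end

open MeasureTheory ProbabilityTheory Filter Topology

noncomputable section

namespace MimoAVC

open scoped ENNReal NNReal Matrix

/-! The jammer has an oblivious strategy: aim `g` along the first eigenvector of the noise
covariance and draw `s` with i.i.d. centred Gaussian entries of variance `l`. By rotation invariance
the jammed noise is Gaussian with the spectrum of `S`, the first eigenvalue raised by `l`
(`map_jammed_noise`). For `l < Λ` the power constraint holds with probability tending to one, so the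
average error under this jammer is at most the maximal error plus `o(1)`.

The converse for that Gaussian channel is a change of measure. Every output law is compared with one
reference law `Q`, the waterfilling output: independent Gaussian coordinates of variance `max γ (τ
m)`. Under `Q` the decoding regions have total mass one whatever the codewords, and by
`waterfilling_le` every admissible codeword has relative entropy to `Q` at most `n` times a common
rate. Hence `log N * (1 - ε) ≤ n * K + 1` (`log_mul_one_sub_error_le`). Dividing by `n` and letting
`n → ∞`, then `l → Λ`, gives the bound. -/

/-! ### Relative entropy and change of measure -/

/-- `Q` has density `exp (-L)` with respect to `P`, where `L` has `P`-mean at most `k`: this bounds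
the relative entropy of `P` with respect to `Q` by `k`. -/
def KLBound {α : Type*} [MeasurableSpace α] (P Q : Measure α) (k : ℝ) : Prop :=
  ∃ L : α → ℝ, Measurable L ∧ Integrable L P ∧ ∫ y, L y ∂P ≤ k ∧
    Q = P.withDensity fun y => ENNReal.ofReal (Real.exp (-L y))

/-- Integrate `1 + x ≤ exp x` against `P`, with `x = log a - L` on `D` and `x = -L` off `D`. The sum
of the two bounds has `1` on the left, which absorbs `Q Dᶜ ≤ 1`. -/
theorem KLBound.log_mul_measureReal_le {α : Type*} [MeasurableSpace α] {P Q : Measure α}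
    [IsProbabilityMeasure P] [IsProbabilityMeasure Q] {k : ℝ} (h : KLBound P Q k)
    {D : Set α} (hD : MeasurableSet D) {a : ℝ} (ha : 0 < a) :
    Real.log a * P.real D ≤ k + a * Q.real D := by
  obtain ⟨L, hL, hLi, hk, rfl⟩ := h
  set Q := P.withDensity fun y => ENNReal.ofReal (Real.exp (-L y))
  have hexp : Integrable (fun y => Real.exp (-L y)) P := by
    refine ⟨by fun_prop, ?_⟩
    rw [hasFiniteIntegral_iff_ofReal (ae_of_all _ fun y => (Real.exp_pos _).le)]
    rw [← setLIntegral_univ, ← withDensity_apply _ MeasurableSet.univ]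
    exact measure_lt_top Q _
  have hQ : ∀ E, MeasurableSet E → Q.real E = ∫ y in E, Real.exp (-L y) ∂P := by
    intro E hE
    rw [measureReal_def, withDensity_apply _ hE, integral_eq_lintegral_of_nonneg_ae
      (ae_of_all _ fun y => (Real.exp_pos _).le) (by fun_prop)]
  have h1 : ∫ y in D, (Real.log a + 1 - L y) ∂P ≤ ∫ y in D, a * Real.exp (-L y) ∂P := by
    refine integral_mono ?_ (hexp.const_mul a).integrableOn fun y => ?_
    · exact ((integrable_const _).sub hLi).integrableOn
    · have := Real.add_one_le_exp (Real.log a + -L y)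
      rw [Real.exp_add, Real.exp_log ha] at this
      simp only
      linarith
  have h2 : ∫ y in Dᶜ, (1 - L y) ∂P ≤ ∫ y in Dᶜ, Real.exp (-L y) ∂P := by
    refine integral_mono ?_ hexp.integrableOn fun y => ?_
    · exact ((integrable_const _).sub hLi).integrableOn
    · have := Real.add_one_le_exp (-L y)
      simp only
      linarith
  rw [integral_const_mul, ← hQ _ hD, integral_sub (integrable_const _) hLi.integrableOn,
    setIntegral_const] at h1
  rw [← hQ _ hD.compl, integral_sub (integrable_const _) hLi.integrableOn,
    setIntegral_const] at h2
  have h3 := integral_add_compl hD hLi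
  have h4 := probReal_compl_eq_one_sub (μ := P) hD
  have h5 := measureReal_le_one (μ := Q) (s := Dᶜ)
  simp only [smul_eq_mul] at h1 h2
  nlinarith

theorem pi_withDensity {ι : Type*} [Fintype ι] {X : ι → Type*} [∀ i, MeasurableSpace (X i)]
    (μ : ∀ i, Measure (X i)) [∀ i, IsProbabilityMeasure (μ i)] (f : ∀ i, X i → ℝ≥0∞)
    (hf : ∀ i, Measurable (f i)) [∀ i, SigmaFinite ((μ i).withDensity (f i))] :
    Measure.pi (fun i => (μ i).withDensity (f i)) =
      (Measure.pi μ).withDensity fun x => ∏ i, f i (x i) := by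
  refine Measure.pi_eq fun s hs => ?_
  rw [withDensity_apply _ (MeasurableSet.univ_pi hs),
    ← lintegral_indicator (MeasurableSet.univ_pi hs)]
  have hind : ∀ x : ∀ i, X i, (Set.univ.pi s).indicator (fun x => ∏ i, f i (x i)) x =
      ∏ i, (s i).indicator (f i) (x i) := by
    intro x
    by_cases hx : x ∈ Set.univ.pi s
    · rw [Set.indicator_of_mem hx]
      exact Finset.prod_congr rfl fun i _ =>
        (Set.indicator_of_mem (hx i (Set.mem_univ i)) _).symm
    · rw [Set.indicator_of_notMem hx]
      simp only [Set.mem_univ_pi, not_forall] at hx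
      obtain ⟨i, hi⟩ := hx
      exact (Finset.prod_eq_zero (Finset.mem_univ i) (Set.indicator_of_notMem hi _)).symm
  simp_rw [hind]
  have hm : ∀ i, Measurable ((s i).indicator (f i)) := fun i => (hf i).indicator (hs i)
  have := lintegral_prod_eq_prod_lintegral_of_indepFun (μ := Measure.pi μ) Finset.univ
    (fun i x => (s i).indicator (f i) (x i))
    (iIndepFun_pi fun i => (hm i).aemeasurable) (fun i => (hm i).comp (measurable_pi_apply i))
  rw [this]
  refine Finset.prod_congr rfl fun i _ => ?_
  rw [withDensity_apply _ (hs i), ← lintegral_indicator (hs i),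
    ← (measurePreserving_eval μ i).lintegral_comp (hm i)]

/-- Log-likelihood ratios of independent coordinates add, so relative entropies do too. -/
theorem KLBound.pi {ι : Type*} [Fintype ι] {X : ι → Type*} [∀ i, MeasurableSpace (X i)]
    {P Q : ∀ i, Measure (X i)} [∀ i, IsProbabilityMeasure (P i)]
    [∀ i, IsProbabilityMeasure (Q i)] {k : ι → ℝ} (h : ∀ i, KLBound (P i) (Q i) (k i)) :
    KLBound (Measure.pi P) (Measure.pi Q) (∑ i, k i) := by
  choose L hL hLi hk hQ using h
  have hint : ∀ i, Integrable (fun y : ∀ i, X i => L i (y i)) (Measure.pi P) := fun i =>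
    integrable_comp_eval (hLi i)
  refine ⟨fun y => ∑ i, L i (y i), ?_, integrable_finsetSum _ fun i _ => hint i, ?_, ?_⟩
  · exact Finset.measurable_sum _ fun i _ => (hL i).comp (measurable_pi_apply i)
  · rw [integral_finsetSum _ fun i _ => hint i]
    refine Finset.sum_le_sum fun i _ => ?_
    rw [integral_comp_eval (hL i).aestronglyMeasurable]
    exact hk i
  · have hQ' : Q = fun i => (P i).withDensity fun y => ENNReal.ofReal (Real.exp (-L i y)) :=
      funext hQ
    have : ∀ i, SigmaFinite ((P i).withDensity fun y => ENNReal.ofReal (Real.exp (-L i y))) :=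
      fun i => hQ i ▸ inferInstance
    rw [hQ', pi_withDensity _ _ fun i => by have := hL i; fun_prop]
    congr with y
    rw [← ENNReal.ofReal_prod_of_nonneg fun i _ => (Real.exp_pos _).le, ← Real.exp_sum,
      Finset.sum_neg_distrib]

theorem KLBound.mono {α : Type*} [MeasurableSpace α] {P Q : Measure α} {k k' : ℝ}
    (h : KLBound P Q k) (hk : k ≤ k') : KLBound P Q k' := by
  obtain ⟨L, hL, hLi, hk', hQ⟩ := h
  exact ⟨L, hL, hLi, hk'.trans hk, hQ⟩

/-! ### Relative entropy of Gaussians -/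

theorem integrable_sq_gaussianReal (x : ℝ) (v : ℝ≥0) :
    Integrable (fun y => y ^ 2) (gaussianReal x v) :=
  (memLp_id_gaussianReal 2).integrable_sq

theorem integral_sq_gaussianReal (x : ℝ) (v : ℝ≥0) :
    ∫ y, y ^ 2 ∂gaussianReal x v = x ^ 2 + v := by
  have h := variance_eq_sub (memLp_id_gaussianReal (μ := x) (v := v) 2)
  rw [variance_id_gaussianReal] at h
  simp only [id_eq, integral_id_gaussianReal, Pi.pow_apply] at h
  linarith

/-- The constant is the exact relative entropy: `L` is the log-likelihood ratio, a quadratic in `y`,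
so its mean needs only the first two moments. -/
theorem klBound_gaussianReal (x : ℝ) {v w : ℝ≥0} (hv : v ≠ 0) (hw : w ≠ 0) :
    KLBound (gaussianReal x v) (gaussianReal 0 w)
      (1 / 2 * Real.log (w / v) + (x ^ 2 + v) / (2 * w) - 1 / 2) := by
  have hv' : (0 : ℝ) < v := by positivity
  have hw' : (0 : ℝ) < w := by positivity
  have hi : Integrable (fun y => y) (gaussianReal x v) :=
    (memLp_id_gaussianReal 1).integrable le_rfl
  have hi2 := integrable_sq_gaussianReal x v
  have hform : ∀ y : ℝ, 1 / 2 * Real.log (w / v) + y ^ 2 / (2 * w) - (y - x) ^ 2 / (2 * v) =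
      (1 / 2 * Real.log (w / v) - x ^ 2 / (2 * v)) + (1 / (2 * w) - 1 / (2 * v)) * y ^ 2 +
        x / v * y := fun y => by field_simp; ring
  have hi3 : Integrable (fun y => (1 / 2 * Real.log (w / v) - x ^ 2 / (2 * v)) +
      (1 / (2 * w) - 1 / (2 * v)) * y ^ 2) (gaussianReal x v) :=
    (integrable_const _).add (hi2.const_mul _)
  refine ⟨fun y => 1 / 2 * Real.log (w / v) + y ^ 2 / (2 * w) - (y - x) ^ 2 / (2 * v),
    by fun_prop, ?_, ?_, ?_⟩
  · simp_rw [hform]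
    exact hi3.add (hi.const_mul _)
  · simp_rw [hform]
    rw [integral_add hi3 (hi.const_mul _), integral_add (integrable_const _) (hi2.const_mul _), integral_const_mul, integral_const_mul,
      integral_sq_gaussianReal, integral_id_gaussianReal]
    simp only [integral_const, probReal_univ, smul_eq_mul]
    apply le_of_eq
    field_simp
    ring
  · rw [gaussianReal_of_var_ne_zero _ hv, gaussianReal_of_var_ne_zero _ hw,
      ← withDensity_mul _ (measurable_gaussianPDF _ _) (by fun_prop)]
    congr with y
    simp only [Pi.mul_apply, gaussianPDF_def]
    rw [← ENNReal.ofReal_mul (gaussianPDFReal_nonneg _ _ _)]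
    congr 1
    simp only [gaussianPDFReal_def]
    -- The logarithmic term of `L` accounts for the ratio of the normalising constants of the two
    -- densities.
    have hs : Real.exp (-(1 / 2 * Real.log (w / v))) = √(2 * Real.pi * v) / √(2 * Real.pi * w) := by
      rw [← Real.sqrt_div (by positivity), mul_div_mul_left _ _ (by positivity),
        Real.sqrt_eq_rpow, Real.rpow_def_of_pos (by positivity)]
      congr 1
      rw [← inv_div (w : ℝ) v, Real.log_inv]
      ring
    have he : Real.exp (-(1 / 2 * Real.log (w / v) + y ^ 2 / (2 * w) - (y - x) ^ 2 / (2 * v))) =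
        Real.exp (-(1 / 2 * Real.log (w / v))) * (Real.exp (-(y - 0) ^ 2 / (2 * w)) *
          Real.exp ((y - x) ^ 2 / (2 * v))) := by
      rw [← Real.exp_add, ← Real.exp_add]
      congr 1
      ring
    rw [he, hs, neg_div ((2 : ℝ) * v), Real.exp_neg]
    have : 0 < √(2 * Real.pi * v) := by positivity
    field_simp

/-! ### Eigenbasis coordinates and the jammed noise -/

/-- The vector with coordinates `z` in the basis formed by the columns of `U`. -/
def rotate {M : ℕ} (U : Matrix (Fin M) (Fin M) ℝ) (z : Fin M → ℝ) : EuclideanSpace ℝ (Fin M) :=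
  WithLp.toLp 2 (U *ᵥ z)

@[fun_prop]
theorem measurable_rotate {M : ℕ} (U : Matrix (Fin M) (Fin M) ℝ) : Measurable (rotate U) := by
  unfold rotate
  have : Continuous fun z => U *ᵥ z := by fun_prop
  exact (PiLp.continuous_toLp 2 _).comp this |>.measurable

theorem norm_rotate_sq {M : ℕ} {U : Matrix (Fin M) (Fin M) ℝ}
    (hU : U ∈ Matrix.orthogonalGroup (Fin M) ℝ) (z : Fin M → ℝ) :
    ‖rotate U z‖ ^ 2 = ∑ m, z m ^ 2 := by
  have h : (U *ᵥ z) ⬝ᵥ (U *ᵥ z) = z ⬝ᵥ z := by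
    rw [Matrix.dotProduct_mulVec, Matrix.vecMul_mulVec,
      (Matrix.mem_orthogonalGroup_iff' (Fin M) ℝ).1 hU, Matrix.vecMul_one]
  rw [EuclideanSpace.real_norm_sq_eq]
  simpa [rotate, dotProduct, sq] using h

theorem exists_rotate_eq {M : ℕ} {U : Matrix (Fin M) (Fin M) ℝ}
    (hU : U ∈ Matrix.orthogonalGroup (Fin M) ℝ) (x : EuclideanSpace ℝ (Fin M)) :
    ∃ z, rotate U z = x :=
  ⟨Uᵀ *ᵥ x, by
    ext m
    simp only [rotate]
    rw [Matrix.mulVec_mulVec, (Matrix.mem_orthogonalGroup_iff (Fin M) ℝ).1 hU, Matrix.one_mulVec]⟩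

theorem rotate_add {M : ℕ} (U : Matrix (Fin M) (Fin M) ℝ) (z z' : Fin M → ℝ) :
    rotate U (z + z') = rotate U z + rotate U z' := by
  simp [rotate, Matrix.mulVec_add]

theorem inner_rotate {M : ℕ} (U : Matrix (Fin M) (Fin M) ℝ) (z : Fin M → ℝ)
    (t : EuclideanSpace ℝ (Fin M)) :
    inner ℝ (rotate U z) t = inner ℝ (WithLp.toLp 2 z) (WithLp.toLp 2 (Uᵀ *ᵥ t)) := by
  simp only [rotate, EuclideanSpace.inner_eq_star_dotProduct, star_trivial]
  rw [Matrix.dotProduct_mulVec, Matrix.mulVec_transpose]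

theorem charFun_rotate {M : ℕ} (U : Matrix (Fin M) (Fin M) ℝ) (v : Fin M → ℝ≥0)
    (t : EuclideanSpace ℝ (Fin M)) :
    charFun ((Measure.pi fun m => gaussianReal 0 (v m)).map (rotate U)) t =
      Complex.exp (-((∑ m, v m * (Uᵀ *ᵥ t) m ^ 2 : ℝ) : ℂ) / 2) := by
  have h : charFun ((Measure.pi fun m => gaussianReal 0 (v m)).map (rotate U)) t =
      charFun ((Measure.pi fun m => gaussianReal 0 (v m)).map (WithLp.toLp 2))
        (WithLp.toLp 2 (Uᵀ *ᵥ t)) := by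
    rw [charFun_apply, charFun_apply, integral_map (by fun_prop) (by fun_prop),
      integral_map (by fun_prop) (by fun_prop)]
    simp_rw [inner_rotate]
  rw [h, charFun_pi]
  simp_rw [charFun_gaussianReal]
  rw [← Complex.exp_sum]
  congr 1
  push_cast
  rw [neg_div, Finset.sum_div, ← Finset.sum_neg_distrib]
  refine Finset.sum_congr rfl fun m _ => ?_
  simp

/-- Adding a Gaussian multiple of an eigenvector to Gaussian noise changes one eigenvalue of the
covariance matrix. -/
theorem map_smul_add_multivariateGaussian {M : ℕ} {S : Matrix (Fin M) (Fin M) ℝ} (hS : S.PosDef)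
    {σsq : Fin M → ℝ} {U : Matrix (Fin M) (Fin M) ℝ}
    (hSU : S = U * Matrix.diagonal σsq * U.transpose) (j : Fin M) (l : ℝ≥0) (v : Fin M → ℝ≥0)
    (hv : ∀ m, (v m : ℝ) = σsq m + if m = j then (l : ℝ) else 0) :
    ((gaussianReal 0 l).prod (multivariateGaussian 0 S)).map
        (fun p => p.1 • rotate U (Pi.single j 1) + p.2) =
      (Measure.pi fun m => gaussianReal 0 (v m)).map (rotate U) := by
  set u := rotate U (Pi.single j 1)
  have hmeas : Measurable fun p : ℝ × EuclideanSpace ℝ (Fin M) => p.1 • u + p.2 := by fun_prop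
  have : IsProbabilityMeasure (((gaussianReal 0 l).prod (multivariateGaussian 0 S)).map
      (fun p => p.1 • u + p.2)) := Measure.isProbabilityMeasure_map hmeas.aemeasurable
  have : IsProbabilityMeasure ((Measure.pi fun m => gaussianReal 0 (v m)).map (rotate U)) :=
    Measure.isProbabilityMeasure_map (by fun_prop)
  apply Measure.ext_of_charFun
  ext t
  rw [charFun_rotate]
  have hu : inner ℝ u t = (Uᵀ *ᵥ t) j := by
    rw [inner_rotate, EuclideanSpace.inner_eq_star_dotProduct]
    simp
  have h1 : charFun (((gaussianReal 0 l).prod (multivariateGaussian 0 S)).map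
      (fun p => p.1 • u + p.2)) t =
      charFun (gaussianReal 0 l) ((Uᵀ *ᵥ t) j) * charFun (multivariateGaussian 0 S) t := by
    rw [charFun_apply, integral_map (by fun_prop) (by fun_prop), charFun_apply, charFun_apply,
      ← integral_prod_mul]
    refine integral_congr_ae (ae_of_all _ fun p => ?_)
    simp only
    rw [← Complex.exp_add, inner_add_left, real_inner_smul_left, hu]
    congr 1
    simp [mul_comm]
    ring
  rw [h1, charFun_gaussianReal, charFun_multivariateGaussian hS.posSemidef, ← Complex.exp_add]
  congr 1
  -- In eigenbasis coordinates the covariance form is diagonal, and the Gaussian multiple of `u`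
  -- adds `l` to the coefficient of the `j`-th square.
  have hq : t.ofLp ⬝ᵥ S *ᵥ t.ofLp = ∑ m, σsq m * (Uᵀ *ᵥ t) m ^ 2 := by
    rw [hSU, ← Matrix.mulVec_mulVec, ← Matrix.mulVec_mulVec, Matrix.dotProduct_mulVec,
      ← Matrix.mulVec_transpose]
    simp only [dotProduct, Matrix.mulVec_diagonal]
    exact Finset.sum_congr rfl fun m _ => by ring
  rw [hq]
  simp_rw [hv, add_mul, Finset.sum_add_distrib, ite_mul, zero_mul]
  simp
  ring

/-- The jammed noise of a block, when the jamming signal is Gaussian. -/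
theorem map_jammed_noise {M : ℕ} (n : ℕ) {S : Matrix (Fin M) (Fin M) ℝ} (hS : S.PosDef)
    {σsq : Fin M → ℝ} {U : Matrix (Fin M) (Fin M) ℝ}
    (hSU : S = U * Matrix.diagonal σsq * U.transpose) (j : Fin M) (l : ℝ≥0) (v : Fin M → ℝ≥0)
    (hv : ∀ m, (v m : ℝ) = σsq m + if m = j then (l : ℝ) else 0) :
    ((Measure.pi fun _ : Fin n => gaussianReal 0 l).prod (noise n S)).map
        (fun p t => p.1 t • rotate U (Pi.single j 1) + p.2 t) =
      (Measure.pi fun _ : Fin n => Measure.pi fun m => gaussianReal 0 (v m)).map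
        (fun z t => rotate U (z t)) := by
  have hmeas : Measurable fun p : ℝ × EuclideanSpace ℝ (Fin M) =>
    p.1 • rotate U (Pi.single j 1) + p.2 := by fun_prop
  have : IsProbabilityMeasure (((gaussianReal 0 l).prod (multivariateGaussian 0 S)).map
      (fun p => p.1 • rotate U (Pi.single j 1) + p.2)) :=
    Measure.isProbabilityMeasure_map hmeas.aemeasurable
  have : IsProbabilityMeasure ((Measure.pi fun m => gaussianReal 0 (v m)).map (rotate U)) :=
    Measure.isProbabilityMeasure_map (by fun_prop)
  -- Regroup the pair of sequences as a sequence of independent pairs, so that the one-row identity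
  -- applies in each row.
  have h := measurePreserving_arrowProdEquivProdArrow ℝ (EuclideanSpace ℝ (Fin M)) (Fin n)
    (fun _ => gaussianReal 0 l) (fun _ => multivariateGaussian 0 S)
  rw [noise, ← h.map_eq, Measure.map_map (by fun_prop) (by fun_prop)]
  refine Eq.trans ?_ (Measure.pi_map_pi
    (μ := fun _ : Fin n => Measure.pi fun m => gaussianReal 0 (v m))
    (f := fun _ => rotate U) fun _ => (measurable_rotate U).aemeasurable).symm
  rw [← map_smul_add_multivariateGaussian hS hSU j l v hv]
  exact (Measure.pi_map_pi (μ := fun _ : Fin n => (gaussianReal 0 l).prod (multivariateGaussian 0 S))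
      (f := fun _ p => p.1 • rotate U (Pi.single j 1) + p.2) fun _ => hmeas.aemeasurable)

/-! ### Converse for a deterministic code -/

/-- The reference law `Q` does not depend on the message, so the decoding regions share a total
`Q`-mass of one. Each message contributes `k` plus `N` times the `Q`-mass of its region. -/
theorem sum_log_mul_success_le {n N M : ℕ} {U : Matrix (Fin M) (Fin M) ℝ}
    (hU : U ∈ Matrix.orthogonalGroup (Fin M) ℝ) {v w : Fin M → ℝ≥0} (hv : ∀ m, v m ≠ 0)
    (hw : ∀ m, w m ≠ 0) {Γ k : ℝ}
    (hk : ∀ ξ : Fin n → Fin M → ℝ, ∑ t, ∑ m, ξ t m ^ 2 ≤ n * Γ →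
      ∑ t, ∑ m, (1 / 2 * Real.log (w m / v m) + (ξ t m ^ 2 + v m) / (2 * w m) - 1 / 2) ≤ k)
    (hN : 0 < N) (c : DetCode n N M Γ) (hc : Measurable c.dec) :
    Real.log N * ∑ i, (Measure.pi fun _ : Fin n => Measure.pi fun m => gaussianReal 0 (v m)).real
      {z | c.dec (fun t => c.enc i t + rotate U (z t)) = i} ≤ N * k + N := by
  set Q := Measure.pi fun _ : Fin n => Measure.pi fun m => gaussianReal 0 (w m)
  have hdec : Measurable fun y : Fin n → Fin M → ℝ => c.dec fun t => rotate U (y t) :=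
    hc.comp (by fun_prop)
  set D : Fin N → Set (Fin n → Fin M → ℝ) := fun i => {y | c.dec (fun t => rotate U (y t)) = i}
  have hD : ∀ i, MeasurableSet (D i) := fun i => hdec (measurableSet_singleton i)
  have hsum : ∑ i, Q.real (D i) = 1 := by
    have := sum_measureReal_preimage_singleton (μ := Q) Finset.univ
      (f := fun y : Fin n → Fin M → ℝ => c.dec fun t => rotate U (y t)) fun i _ => hD i
    exact this.trans (by simp)
  have hi : ∀ i, Real.log N *
      (Measure.pi fun _ : Fin n => Measure.pi fun m => gaussianReal 0 (v m)).real
        {z | c.dec (fun t => c.enc i t + rotate U (z t)) = i} ≤ k + N * Q.real (D i) := by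
    intro i
    choose ξ hξ using fun t => exists_rotate_eq hU (c.enc i t)
    have hpow : ∑ t, ∑ m, ξ t m ^ 2 ≤ n * Γ := by
      simp_rw [← norm_rotate_sq hU, hξ]
      exact c.power_le i
    have hkl : KLBound (Measure.pi fun t => Measure.pi fun m => gaussianReal (ξ t m) (v m)) Q k :=
      (KLBound.pi fun t => KLBound.pi fun m =>
        klBound_gaussianReal (ξ t m) (hv m) (hw m)).mono (hk ξ hpow)
    have hshift : (Measure.pi fun _ : Fin n => Measure.pi fun m => gaussianReal 0 (v m)).map
        (fun z t m => ξ t m + z t m) =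
        Measure.pi fun t => Measure.pi fun m => gaussianReal (ξ t m) (v m) := by
      have h1 : ∀ t, (Measure.pi fun m => gaussianReal 0 (v m)).map (fun z m => ξ t m + z m) =
          Measure.pi fun m => gaussianReal (ξ t m) (v m) := by
        intro t
        have hm : ∀ m, gaussianReal (ξ t m) (v m) =
            (gaussianReal 0 (v m)).map fun y => ξ t m + y := fun m => by
          rw [gaussianReal_map_const_add, zero_add]
        simp_rw [hm]
        exact (Measure.pi_map_pi (μ := fun m => gaussianReal 0 (v m))
          (f := fun m y => ξ t m + y) fun _ => by fun_prop)
      have h2 : ∀ t, IsProbabilityMeasure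
          ((Measure.pi fun m => gaussianReal 0 (v m)).map (fun z m => ξ t m + z m)) :=
        fun t => by rw [h1]; infer_instance
      simp_rw [← h1]
      exact (Measure.pi_map_pi (μ := fun _ : Fin n => Measure.pi fun m => gaussianReal 0 (v m))
        (f := fun t z m => ξ t m + z m) fun t =>
          Measurable.aemeasurable (by fun_prop))
    -- With `a = N` the `Q`-masses contribute `N` in total, that is, `1` per message on average.
    have := hkl.log_mul_measureReal_le (hD i) (a := N) (by positivity)
    rw [← hshift, map_measureReal_apply (by fun_prop) (hD i)] at this
    convert! this using 3
    ext z
    simp only [D, Set.mem_preimage, Set.mem_ofPred_eq]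
    have : (fun t => c.enc i t + rotate U (z t)) = fun t => rotate U fun m => ξ t m + z t m := by
      ext1 t
      rw [← hξ, ← rotate_add]
      rfl
    rw [this]
  rw [Finset.mul_sum]
  calc _ ≤ ∑ i, (k + N * Q.real (D i)) := Finset.sum_le_sum fun i _ => hi i
    _ = N * k + N := by
      rw [Finset.sum_add_distrib, ← Finset.mul_sum, hsum]
      simp

/-! ### Waterfilling -/

/-- The slope `1 / (2 * γ)` is the Lagrange multiplier of the power constraint. When `τ m ≤ γ`,
energy in coordinate `m` is priced exactly at this slope, relative to the allocation `γ - τ m`; when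
`τ m > γ` its price `1 / (2 * τ m)` is lower. Summing, the energy terms cancel up to the power
slack, which has the right sign. -/
theorem waterfilling_le {n M : ℕ} {Γ γ : ℝ} {τ v : Fin M → ℝ} (hγ : 0 < γ) (hvτ : ∀ m, v m ≤ τ m)
    (hτ : ∑ m, max (γ - τ m) 0 = Γ) (ξ : Fin n → Fin M → ℝ)
    (hξ : ∑ t, ∑ m, ξ t m ^ 2 ≤ n * Γ) :
    ∑ t, ∑ m, (1 / 2 * Real.log (max γ (τ m) / v m) + (ξ t m ^ 2 + v m) / (2 * max γ (τ m)) -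
      1 / 2) ≤ n * ∑ m, 1 / 2 * Real.log (max γ (τ m) / v m) := by
  have h : ∀ t m, 1 / 2 * Real.log (max γ (τ m) / v m) +
      (ξ t m ^ 2 + v m) / (2 * max γ (τ m)) - 1 / 2 ≤
      1 / 2 * Real.log (max γ (τ m) / v m) + (ξ t m ^ 2 - max (γ - τ m) 0) / (2 * γ) := by
    intro t m
    have h1 : (ξ t m ^ 2 + v m) / (2 * max γ (τ m)) ≤
        (ξ t m ^ 2 + τ m) / (2 * max γ (τ m)) := by
      have := hvτ m
      gcongr
    have h2 : (ξ t m ^ 2 + τ m) / (2 * max γ (τ m)) - 1 / 2 ≤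
        (ξ t m ^ 2 - max (γ - τ m) 0) / (2 * γ) := by
      rcases le_total (τ m) γ with hle | hle
      · rw [max_eq_left hle, max_eq_left (sub_nonneg.2 hle)]
        apply le_of_eq
        field_simp
        ring
      · rw [max_eq_right hle, max_eq_right (sub_nonpos.2 hle), sub_zero]
        have hpos : 0 < τ m := hγ.trans_le hle
        have : (ξ t m ^ 2 + τ m) / (2 * τ m) - 1 / 2 = ξ t m ^ 2 / (2 * τ m) := by
          field_simp
          ring
        rw [this]
        gcongr
    linarith
  calc _ ≤ ∑ t : Fin n, ∑ m, (1 / 2 * Real.log (max γ (τ m) / v m) +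
        (ξ t m ^ 2 - max (γ - τ m) 0) / (2 * γ)) :=
        Finset.sum_le_sum fun t _ => Finset.sum_le_sum fun m _ => h t m
    _ = n * ∑ m, 1 / 2 * Real.log (max γ (τ m) / v m) +
        (∑ t, ∑ m, ξ t m ^ 2 - n * Γ) / (2 * γ) := by
      simp_rw [Finset.sum_add_distrib, ← Finset.sum_div, Finset.sum_sub_distrib, hτ]
      simp
    _ ≤ _ := by
      have : (∑ t, ∑ m, ξ t m ^ 2 - n * Γ) / (2 * γ) ≤ 0 :=
        div_nonpos_of_nonpos_of_nonneg (by linarith) (by positivity)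
      linarith

section WaterLevel

variable {M : ℕ} {τ : Fin M → ℝ} {Γ : ℝ}

theorem bddAbove_feasibleLevels (hM : 0 < M) : BddAbove (feasibleLevels τ Γ) := by
  refine ⟨τ ⟨0, hM⟩ + Γ, fun γ hγ => ?_⟩
  have h1 := Finset.single_le_sum (f := fun m => max (γ - τ m) 0) (fun m _ => le_max_right _ _)
    (Finset.mem_univ ⟨0, hM⟩)
  have h2 := le_max_left (γ - τ ⟨0, hM⟩) 0
  simp only [feasibleLevels, Set.mem_ofPred_eq] at hγ
  linarith

/-- A level equal to the smallest noise variance uses no power. -/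
theorem exists_mem_feasibleLevels (hM : 0 < M) (hΓ : 0 ≤ Γ) (τ : Fin M → ℝ) :
    ∃ m, τ m ∈ feasibleLevels τ Γ := by
  have : Nonempty (Fin M) := ⟨⟨0, hM⟩⟩
  obtain ⟨m, hm⟩ := Finite.exists_min τ
  refine ⟨m, ?_⟩
  simp only [feasibleLevels, Set.mem_ofPred_eq]
  rw [Finset.sum_eq_zero fun i _ => max_eq_right (sub_nonpos.2 (hm i))]
  exact hΓ

theorem isGreatest_waterLevel (hM : 0 < M) (hΓ : 0 ≤ Γ) :
    IsGreatest (feasibleLevels τ Γ) (waterLevel τ Γ) := by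
  have hb : BddAbove (feasibleLevels τ Γ) := bddAbove_feasibleLevels hM
  obtain ⟨m, hm⟩ := exists_mem_feasibleLevels hM hΓ τ
  have hc : IsClosed (feasibleLevels τ Γ) := isClosed_le (by fun_prop) continuous_const
  exact ⟨hc.csSup_mem ⟨_, hm⟩ hb, fun γ hγ => le_csSup hb hγ⟩

theorem waterLevel_pos (hM : 0 < M) (hΓ : 0 ≤ Γ) (hτ : ∀ m, 0 < τ m) : 0 < waterLevel τ Γ := by
  obtain ⟨m, hm⟩ := exists_mem_feasibleLevels hM hΓ τ
  exact (hτ m).trans_le ((isGreatest_waterLevel hM hΓ).2 hm)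

theorem sum_waterLevel (hM : 0 < M) (hΓ : 0 ≤ Γ) :
    ∑ m, max (waterLevel τ Γ - τ m) 0 = Γ := by
  have hg := isGreatest_waterLevel (τ := τ) hM hΓ
  refine le_antisymm hg.1 (not_lt.1 fun hlt => ?_)
  -- Unused power, split evenly over the `M` coordinates: raising the level by `δ` costs at most `M
  -- * δ`, against maximality.
  set δ := (Γ - ∑ m, max (waterLevel τ Γ - τ m) 0) / M
  have hM' : (0 : ℝ) < M := by exact_mod_cast hM
  have hδ : 0 < δ := div_pos (sub_pos.2 hlt) hM'
  have hmem : waterLevel τ Γ + δ ∈ feasibleLevels τ Γ := by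
    simp only [feasibleLevels, Set.mem_ofPred_eq]
    calc _ ≤ ∑ m, (max (waterLevel τ Γ - τ m) 0 + δ) := Finset.sum_le_sum fun m _ => by
          refine max_le ?_ ?_
          · linarith [le_max_left (waterLevel τ Γ - τ m) 0]
          · linarith [le_max_right (waterLevel τ Γ - τ m) 0]
      _ = Γ := by
        rw [Finset.sum_add_distrib]
        simp only [Finset.sum_const, Finset.card_univ, Fintype.card_fin, nsmul_eq_mul, δ]
        field_simp
        ring
  linarith [hg.2 hmem]

/-- Rewrites the rate as half log-ratios of output variance to noise variance, the form produced by
the relative entropy bound. -/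
theorem waterRate_eq (hτ : ∀ m, 0 < τ m) :
    waterRate τ Γ = ∑ m, 1 / 2 * Real.log (max (waterLevel τ Γ) (τ m) / τ m) := by
  refine Finset.sum_congr rfl fun m _ => ?_
  have := hτ m
  congr 2
  simp only [waterPower]
  rw [← sub_self (τ m), max_sub_sub_right]
  field_simp
  ring

end WaterLevel

/-! ### Power of the Gaussian jammer -/

/-- A Gaussian jamming signal of variance `l < Λ` satisfies the power constraint `Λ` with
probability tending to one. -/
theorem tendsto_gaussian_power_tail {l : ℝ≥0} {Λ : ℝ} (hl : (l : ℝ) < Λ ∨ l = 0 ∧ Λ = 0) :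
    Tendsto (fun n : ℕ => (Measure.pi fun _ : Fin n => gaussianReal 0 l)
      {s | n * Λ < ∑ t, s t ^ 2}) atTop (𝓝 0) := by
  rcases hl with hl | ⟨rfl, rfl⟩
  -- Chebyshev for the sum of squares, whose mean `n * l` lies `n * (Λ - l)` below the threshold;
  -- the variance `n * V` is finite by the fourth moment.
  · set V := Var[fun y : ℝ => y ^ 2; gaussianReal 0 l]
    have hmem : MemLp (fun y : ℝ => y ^ 2) 2 (gaussianReal 0 l) := by
      have h := (memLp_id_gaussianReal (μ := 0) (v := l) 4)
      refine (memLp_two_iff_integrable_sq (by fun_prop)).2 ?_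
      have h4 := h.integrable_norm_pow (by norm_num)
      refine h4.congr (ae_of_all _ fun y => ?_)
      simp only [id_eq, Real.norm_eq_abs]
      have : |y| ^ 4 = (|y| ^ 2) ^ 2 := by ring
      simp [this]
    have hbound : ∀ n : ℕ, 0 < n → (Measure.pi fun _ : Fin n => gaussianReal 0 l)
        {s | n * Λ < ∑ t, s t ^ 2} ≤ ENNReal.ofReal (V / (Λ - l) ^ 2 * (1 / n)) := by
      intro n hn
      have hn' : (0 : ℝ) < n := by exact_mod_cast hn
      set X : (Fin n → ℝ) → ℝ := ∑ t, fun s => s t ^ 2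
      have hX : MemLp X 2 (Measure.pi fun _ : Fin n => gaussianReal 0 l) :=
        memLp_finsetSum' _ fun t _ => hmem.comp_measurePreserving (measurePreserving_eval _ t)
      have hvar : Var[X; Measure.pi fun _ : Fin n => gaussianReal 0 l] = n * V := by
        rw [variance_sum_pi fun _ => hmem]
        simp [V]
      have hmean : ∫ s, X s ∂(Measure.pi fun _ : Fin n => gaussianReal 0 l) = n * l := by
        simp only [X, Finset.sum_apply]
        rw [integral_finsetSum _ fun t _ => integrable_comp_eval
          (μ := fun _ : Fin n => gaussianReal 0 l) (i := t)
          (f := fun y : ℝ => y ^ 2) (integrable_sq_gaussianReal 0 l)]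
        have : ∀ t : Fin n, ∫ s : Fin n → ℝ, s t ^ 2 ∂(Measure.pi fun _ : Fin n =>
            gaussianReal 0 l) = l := fun t => by
          rw [integral_comp_eval (μ := fun _ : Fin n => gaussianReal 0 l)
            (f := fun y : ℝ => y ^ 2) (by fun_prop), integral_sq_gaussianReal]
          simp
        simp [this]
      have hcheb := meas_ge_le_variance_div_sq hX (c := n * (Λ - l))
        (mul_pos hn' (sub_pos.2 hl))
      refine (measure_mono fun s hs => ?_).trans (hcheb.trans_eq ?_)
      · simp only [Set.mem_ofPred_eq] at hs ⊢
        rw [hmean]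
        refine le_trans ?_ (le_abs_self _)
        simp only [X, Finset.sum_apply]
        linarith
      · rw [hvar]
        congr 1
        have := (sub_pos.2 hl).ne'
        field_simp
    refine tendsto_of_tendsto_of_tendsto_of_le_of_le' tendsto_const_nhds ?_
      (Eventually.of_forall fun _ => zero_le)
      ((eventually_gt_atTop 0).mono hbound)
    have := (tendsto_one_div_atTop_nhds_zero_nat (𝕜 := ℝ)).const_mul (V / (Λ - l) ^ 2)
    simpa using ENNReal.tendsto_ofReal this
  -- Zero power: the signal vanishes almost surely, and the strict inequality makes the violation
  -- event null.
  · refine tendsto_const_nhds.congr fun n => ?_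
    have h : ∀ t : Fin n, ∀ᵐ s ∂(Measure.pi fun _ : Fin n => gaussianReal 0 0), s t = 0 := by
      intro t
      refine (measurePreserving_eval (fun _ : Fin n => gaussianReal 0 0)
        t).quasiMeasurePreserving.ae (p := fun y => y = 0) ?_
      rw [gaussianReal_zero_var]
      exact (ae_dirac_iff (measurableSet_singleton 0)).2 rfl
    have h' : ∀ᵐ s ∂(Measure.pi fun _ : Fin n => gaussianReal 0 0), ¬ n * (0 : ℝ) < ∑ t, s t ^ 2 := by
      filter_upwards [ae_all_iff.2 h] with s hs
      simp [hs]
    rw [ae_iff] at h'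
    simpa using h'.symm

/-! ### Averaging over the jammer and the shared randomness -/

instance isProbabilityMeasure_noise (n : ℕ) {M : ℕ} (S : Matrix (Fin M) (Fin M) ℝ) :
    IsProbabilityMeasure (noise n S) := by
  unfold noise
  infer_instance

theorem measurable_det_dec {n N M : ℕ} {Γ : ℝ} (c : RandomizedCode n N M Γ) (ω : c.Ω) :
    Measurable (c.code ω).dec :=
  c.measurable_dec.comp measurable_prodMk_left

/-- By Tonelli the code is fixed first; the jamming signal and the noise then merge into one
Gaussian noise. -/
theorem lintegral_errorProb_gaussian {n N M : ℕ} {Γ : ℝ} {S : Matrix (Fin M) (Fin M) ℝ}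
    (hS : S.PosDef) {σsq : Fin M → ℝ} {U : Matrix (Fin M) (Fin M) ℝ}
    (hSU : S = U * Matrix.diagonal σsq * U.transpose) (j : Fin M) (l : ℝ≥0) (v : Fin M → ℝ≥0)
    (hv : ∀ m, (v m : ℝ) = σsq m + if m = j then (l : ℝ) else 0)
    (c : RandomizedCode n N M Γ) (i : Fin N) :
    ∫⁻ s, errorProb S c (WithLp.toLp 2 s) (rotate U (Pi.single j 1)) i
        ∂(Measure.pi fun _ : Fin n => gaussianReal 0 l) =
      ∫⁻ ω, (Measure.pi fun _ : Fin n => Measure.pi fun m => gaussianReal 0 (v m))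
        {z | (c.code ω).dec (fun t => (c.code ω).enc i t + rotate U (z t)) ≠ i} ∂c.P := by
  set J := Measure.pi fun _ : Fin n => gaussianReal 0 l
  set u := rotate U (Pi.single j 1)
  have henc := c.measurable_enc i
  have hout : Measurable fun p : (Fin n → ℝ) × c.Ω × Block n M =>
      (c.code p.2.1).dec (channelOutput ((c.code p.2.1).enc i) (WithLp.toLp 2 p.1) u p.2.2) := by
    refine c.measurable_dec.comp (f := fun p : (Fin n → ℝ) × c.Ω × Block n M =>
      (p.2.1, channelOutput ((c.code p.2.1).enc i) (WithLp.toLp 2 p.1) u p.2.2)) ?_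
    unfold channelOutput
    refine Measurable.prodMk (by fun_prop) (measurable_pi_lambda _ fun t => ?_)
    have : Measurable fun p : (Fin n → ℝ) × c.Ω × Block n M => (c.code p.2.1).enc i t :=
      (measurable_pi_apply t).comp (henc.comp (measurable_fst.comp measurable_snd))
    fun_prop
  have hE : MeasurableSet {p : (Fin n → ℝ) × c.Ω × Block n M |
      (c.code p.2.1).dec (channelOutput ((c.code p.2.1).enc i) (WithLp.toLp 2 p.1) u p.2.2) ≠ i} :=
    hout (measurableSet_singleton i).compl
  have h1 : ∀ s, errorProb S c (WithLp.toLp 2 s) u i = ∫⁻ ω, noise n S {W | (c.code ω).dec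
      (channelOutput ((c.code ω).enc i) (WithLp.toLp 2 s) u W) ≠ i} ∂c.P := by
    intro s
    have hEs : MeasurableSet {p : c.Ω × Block n M |
        (c.code p.1).dec (channelOutput ((c.code p.1).enc i) (WithLp.toLp 2 s) u p.2) ≠ i} :=
      measurable_prodMk_left (x := s) hE
    rw [errorProb, Measure.prod_apply hEs]
    rfl
  simp_rw [h1]
  rw [lintegral_lintegral_swap]
  · refine lintegral_congr fun ω => ?_
    have hdec : Measurable fun y : Block n M => (c.code ω).dec fun t => (c.code ω).enc i t + y t :=
      (measurable_det_dec c ω).comp (by fun_prop)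
    have hA : MeasurableSet {y : Block n M |
        (c.code ω).dec (fun t => (c.code ω).enc i t + y t) ≠ i} :=
      hdec (measurableSet_singleton i).compl
    have h2 := congrArg (fun μ => μ {y : Block n M |
        (c.code ω).dec (fun t => (c.code ω).enc i t + y t) ≠ i})
      (map_jammed_noise n hS hSU j l v hv)
    rw [Measure.map_apply (by fun_prop) hA, Measure.map_apply (by fun_prop) hA,
      Measure.prod_apply ((by fun_prop : Measurable fun (p : (Fin n → ℝ) × Block n M) t =>
        p.1 t • u + p.2 t) hA)] at h2
    refine Eq.trans (lintegral_congr fun s => ?_) h2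
    congr 1
    ext W
    have : channelOutput ((c.code ω).enc i) (WithLp.toLp 2 s) u W =
        fun t => (c.code ω).enc i t + (s t • u + W t) := by
      ext1 t
      exact add_assoc _ _ _
    simp [this]
  · have : Measurable fun p : (Fin n → ℝ) × c.Ω => noise n S {W | (c.code p.2).dec
        (channelOutput ((c.code p.2).enc i) (WithLp.toLp 2 p.1) u W) ≠ i} := by
      have hE' := MeasurableEquiv.prodAssoc.measurable hE
      exact measurable_measure_prodMk_left hE'
    exact this.aemeasurable

theorem errorProb_le_maxError {n N M : ℕ} {Γ Λ : ℝ} (S : Matrix (Fin M) (Fin M) ℝ)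
    (c : RandomizedCode n N M Γ) {s : EuclideanSpace ℝ (Fin n)} (hs : ‖s‖ ^ 2 ≤ n * Λ)
    {g : EuclideanSpace ℝ (Fin M)} (hg : ‖g‖ = 1) (i : Fin N) :
    errorProb S c s g i ≤ maxError S Λ c :=
  le_iSup₂_of_le s hs <| le_iSup₂_of_le g hg <| le_iSup_of_le i le_rfl

/-- Signals within the power budget are covered by the maximal error; on the others the error is
bounded by one. -/
theorem lintegral_errorProb_le {n N M : ℕ} {Γ Λ : ℝ} (S : Matrix (Fin M) (Fin M) ℝ)
    (c : RandomizedCode n N M Γ) {g : EuclideanSpace ℝ (Fin M)} (hg : ‖g‖ = 1) (i : Fin N)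
    (J : Measure (Fin n → ℝ)) [IsProbabilityMeasure J] :
    ∫⁻ s, errorProb S c (WithLp.toLp 2 s) g i ∂J ≤
      maxError S Λ c + J {s | n * Λ < ∑ t, s t ^ 2} := by
  have hm : MeasurableSet {s : Fin n → ℝ | n * Λ < ∑ t, s t ^ 2} :=
    measurableSet_lt measurable_const (by fun_prop)
  calc _ ≤ ∫⁻ s, (maxError S Λ c + {s : Fin n → ℝ | n * Λ < ∑ t, s t ^ 2}.indicator 1 s) ∂J := by
        refine lintegral_mono fun s => ?_
        by_cases hs : n * Λ < ∑ t, s t ^ 2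
        · rw [Set.indicator_of_mem (show s ∈ {s : Fin n → ℝ | n * Λ < ∑ t, s t ^ 2} from hs)]
          exact le_add_left prob_le_one
        · refine le_add_right (errorProb_le_maxError S c ?_ hg i)
          rw [EuclideanSpace.real_norm_sq_eq]
          exact not_lt.1 hs
    _ = _ := by
      rw [lintegral_add_left measurable_const, lintegral_indicator_one hm]
      simp

/-- The bound for deterministic codes holds for each value of the shared randomness, so it survives
averaging. Each message then succeeds with mean probability at least `1 - ε`, and the factor `N`
cancels. -/
theorem log_mul_one_sub_error_le {n N M : ℕ} {Γ Λ k : ℝ} {S : Matrix (Fin M) (Fin M) ℝ}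
    (hS : S.PosDef) {σsq : Fin M → ℝ} {U : Matrix (Fin M) (Fin M) ℝ}
    (hU : U ∈ Matrix.orthogonalGroup (Fin M) ℝ)
    (hSU : S = U * Matrix.diagonal σsq * U.transpose) (j : Fin M) (l : ℝ≥0) {v w : Fin M → ℝ≥0}
    (hv : ∀ m, (v m : ℝ) = σsq m + if m = j then (l : ℝ) else 0)
    (hv0 : ∀ m, v m ≠ 0) (hw : ∀ m, w m ≠ 0)
    (hk : ∀ ξ : Fin n → Fin M → ℝ, ∑ t, ∑ m, ξ t m ^ 2 ≤ n * Γ →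
      ∑ t, ∑ m, (1 / 2 * Real.log (w m / v m) + (ξ t m ^ 2 + v m) / (2 * w m) - 1 / 2) ≤ k)
    (hN : 0 < N) (c : RandomizedCode n N M Γ)
    (hfin : maxError S Λ c ≠ ∞) :
    Real.log N * (1 - (maxError S Λ c + (Measure.pi fun _ : Fin n => gaussianReal 0 l)
      {s | n * Λ < ∑ t, s t ^ 2}).toReal) ≤ k + 1 := by
  set G := Measure.pi fun _ : Fin n => Measure.pi fun m => gaussianReal 0 (v m)
  set ε := maxError S Λ c + (Measure.pi fun _ : Fin n => gaussianReal 0 l)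
      {s | n * Λ < ∑ t, s t ^ 2}
  have hε : ε ≠ ∞ := ENNReal.add_ne_top.2 ⟨hfin, measure_ne_top _ _⟩
  set e : Fin N → c.Ω → ℝ≥0∞ := fun i ω =>
    G {z | (c.code ω).dec (fun t => (c.code ω).enc i t + rotate U (z t)) ≠ i}
  have hg : ‖rotate U (Pi.single j 1)‖ = 1 := by
    have : ‖rotate U (Pi.single j 1)‖ ^ 2 = 1 := by
      rw [norm_rotate_sq hU]
      simp [Pi.single_apply]
    exact (pow_eq_one_iff_of_nonneg (norm_nonneg _) two_ne_zero).1 this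
  have hle : ∀ i, ∫⁻ ω, e i ω ∂c.P ≤ ε := fun i => by
    rw [← lintegral_errorProb_gaussian hS hSU j l v hv c i]
    exact lintegral_errorProb_le S c hg i _
  have hout : ∀ i, Measurable fun p : c.Ω × (Fin n → Fin M → ℝ) =>
      (c.code p.1).dec (fun t => (c.code p.1).enc i t + rotate U (p.2 t)) := by
    intro i
    refine c.measurable_dec.comp (f := fun p : c.Ω × (Fin n → Fin M → ℝ) =>
      (p.1, fun t => (c.code p.1).enc i t + rotate U (p.2 t))) ?_
    refine Measurable.prodMk (by fun_prop) (measurable_pi_lambda _ fun t => ?_)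
    have : Measurable fun p : c.Ω × (Fin n → Fin M → ℝ) => (c.code p.1).enc i t :=
      (measurable_pi_apply t).comp ((c.measurable_enc i).comp measurable_fst)
    fun_prop
  have hem : ∀ i, Measurable (e i) := fun i =>
    measurable_measure_prodMk_left ((hout i) (measurableSet_singleton i).compl)
  have hint : ∀ i, Integrable (fun ω => (e i ω).toReal) c.P := fun i =>
    integrable_toReal_of_lintegral_ne_top (hem i).aemeasurable
      (ne_top_of_le_ne_top hε (hle i))
  have hint' : ∀ i, Integrable (fun ω => 1 - (e i ω).toReal) c.P := fun i =>
    (integrable_const _).sub (hint i)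
  have hpt : ∀ ω, Real.log N * ∑ i, (1 - (e i ω).toReal) ≤ N * k + N := by
    intro ω
    refine le_of_eq_of_le ?_ (sum_log_mul_success_le hU hv0 hw hk hN (c.code ω)
      (measurable_det_dec c ω))
    congr 1
    refine Finset.sum_congr rfl fun i _ => ?_
    have hD : MeasurableSet {z : Fin n → Fin M → ℝ |
        (c.code ω).dec (fun t => (c.code ω).enc i t + rotate U (z t)) = i} :=
      ((hout i).comp measurable_prodMk_left) (measurableSet_singleton i)
    have := probReal_compl_eq_one_sub (μ := G) hD
    have h2 : (e i ω).toReal = G.real {z : Fin n → Fin M → ℝ |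
        (c.code ω).dec (fun t => (c.code ω).enc i t + rotate U (z t)) = i}ᶜ := rfl
    rw [h2, this, sub_sub_cancel]
  have hI : ∫ ω, Real.log N * ∑ i, (1 - (e i ω).toReal) ∂c.P ≤ N * k + N := by
    calc _ ≤ ∫ _, (N * k + N) ∂c.P := by
          refine integral_mono (Integrable.const_mul (integrable_finsetSum _ fun i _ => hint' i) _) (integrable_const _) hpt
      _ = _ := by simp
  rw [integral_const_mul, integral_finsetSum _ fun i _ => hint' i] at hI
  have hsum : (N : ℝ) * (1 - ε.toReal) ≤ ∑ i, ∫ ω, (1 - (e i ω).toReal) ∂c.P := by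
    calc _ = ∑ _i : Fin N, (1 - ε.toReal) := by simp [mul_sub]
      _ ≤ _ := Finset.sum_le_sum fun i _ => by
        rw [integral_sub (integrable_const _) (hint i), integral_toReal (hem i).aemeasurable
          (ae_lt_top (hem i) (ne_top_of_le_ne_top hε (hle i)))]
        have := ENNReal.toReal_mono hε (hle i)
        simp only [integral_const, probReal_univ, smul_eq_mul, one_mul]
        linarith
  have hlog : 0 ≤ Real.log N := Real.log_natCast_nonneg N
  have hN' : (0 : ℝ) < N := by exact_mod_cast hN
  have h := (mul_le_mul_of_nonneg_left hsum hlog).trans hI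
  refine le_of_mul_le_mul_left ?_ hN'
  linarith

/-! ### Asymptotics and the limit of full jamming power -/

/-- The water level is that of the full power `Λ`, while the actual jammer has variance `l`; the
reference law therefore does not move when `l → Λ`. -/
theorem IsAchievable.le_sum_log {M : ℕ} (hM : 0 < M) {Γ Λ R : ℝ} (hΓ : 0 ≤ Γ)
    {S : Matrix (Fin M) (Fin M) ℝ} (hS : S.PosDef) {σsq : Fin M → ℝ} (hσ : ∀ m, 0 < σsq m)
    {U : Matrix (Fin M) (Fin M) ℝ} (hU : U ∈ Matrix.orthogonalGroup (Fin M) ℝ)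
    (hSU : S = U * Matrix.diagonal σsq * U.transpose) (hR : IsAchievable S Γ Λ R) {l : ℝ}
    (hl0 : 0 ≤ l) (hl : l < Λ ∨ l = 0 ∧ Λ = 0) :
    R ≤ ∑ m, 1 / 2 * Real.log (max (waterLevel (jammedSpectrum σsq Λ) Γ) (jammedSpectrum σsq Λ m) /
      jammedSpectrum σsq l m) := by
  lift l to ℝ≥0 using hl0
  have hlΛ : (l : ℝ) ≤ Λ := by
    rcases hl with h | ⟨h, h'⟩
    · exact h.le
    · rw [h, h']
  set τ := jammedSpectrum σsq Λ with hτdef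
  have hjam : ∀ a : ℝ, 0 ≤ a → ∀ m, 0 < jammedSpectrum σsq a m := by
    intro a ha m
    have := hσ m
    unfold jammedSpectrum
    split_ifs <;> positivity
  have hτ := hjam Λ (l.coe_nonneg.trans hlΛ)
  set γ := waterLevel τ Γ
  have hγ : 0 < γ := waterLevel_pos hM hΓ hτ
  set K := ∑ m, 1 / 2 * Real.log (max γ (τ m) / jammedSpectrum σsq l m)
  obtain ⟨c, hc⟩ := hR
  set v : Fin M → ℝ≥0 := fun m => ⟨jammedSpectrum σsq l m, (hjam l l.coe_nonneg m).le⟩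
  set w : Fin M → ℝ≥0 := fun m => ⟨max γ (τ m), hγ.le.trans (le_max_left _ _)⟩
  have hv : ∀ m, (v m : ℝ) = σsq m + if m = ⟨0, hM⟩ then (l : ℝ) else 0 := by
    intro m
    change jammedSpectrum σsq l m = _
    simp only [jammedSpectrum, Fin.ext_iff]
    split_ifs <;> simp
  have hv0 : ∀ m, v m ≠ 0 := fun m h => (hjam l l.coe_nonneg m).ne' (congrArg NNReal.toReal h)
  have hw0 : ∀ m, w m ≠ 0 := fun m h =>
    (hγ.trans_le (le_max_left γ (τ m))).ne' (congrArg NNReal.toReal h)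
  have hvτ : ∀ m, jammedSpectrum σsq l m ≤ τ m := by
    intro m
    simp only [hτdef, jammedSpectrum]
    split_ifs <;> linarith
  set ε : ℕ → ℝ≥0∞ := fun n => maxError S Λ (c n) +
    (Measure.pi fun _ : Fin n => gaussianReal 0 l) {s | n * Λ < ∑ t, s t ^ 2}
  have hε : Tendsto ε atTop (𝓝 0) := by
    simpa using hc.add (tendsto_gaussian_power_tail (l := l) (by simpa using hl))
  have hεr : Tendsto (fun n => (ε n).toReal) atTop (𝓝 0) := by
    exact (ENNReal.tendsto_toReal ENNReal.zero_ne_top).comp hε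
  have hmain : ∀ᶠ n : ℕ in atTop, R * (1 - (ε n).toReal) ≤ K + 1 / n := by
    filter_upwards [hc.eventually_lt_const ENNReal.zero_lt_top, eventually_gt_atTop 0,
      hεr.eventually_lt_const one_pos] with n hfin hn hε1
    have hn' : (0 : ℝ) < n := by exact_mod_cast hn
    have h := log_mul_one_sub_error_le (k := n * K) (Λ := Λ) hS hU hSU ⟨0, hM⟩ l hv hv0 hw0
      (waterfilling_le hγ hvτ (sum_waterLevel hM hΓ)) (Nat.ceil_pos.2 (Real.exp_pos _)) (c n)
      hfin.ne
    have hlog : n * R ≤ Real.log ⌈Real.exp (n * R)⌉₊ :=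
      (Real.le_log_iff_exp_le (by exact_mod_cast Nat.ceil_pos.2 (Real.exp_pos _))).2
        (Nat.le_ceil _)
    -- This needs `1 - ε n ≥ 0`, which holds only for large `n`.
    have h2 := (mul_le_mul_of_nonneg_right hlog (sub_nonneg.2 hε1.le)).trans h
    refine le_of_mul_le_mul_left ?_ hn'
    have : (n : ℝ) * (K + 1 / n) = n * K + 1 := by field_simp
    rw [this]
    linarith
  have h1 : Tendsto (fun n => R * (1 - (ε n).toReal)) atTop (𝓝 R) := by
    simpa using (hεr.const_sub 1).const_mul R
  have h2 : Tendsto (fun n : ℕ => K + 1 / (n : ℝ)) atTop (𝓝 K) := by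
    simpa using (tendsto_one_div_atTop_nhds_zero_nat (𝕜 := ℝ)).const_add K
  exact le_of_tendsto_of_tendsto h1 h2 hmain

theorem IsAchievable.le_waterRate {M : ℕ} (hM : 0 < M) {Γ Λ R : ℝ} (hΓ : 0 ≤ Γ) (hΛ : 0 ≤ Λ)
    {S : Matrix (Fin M) (Fin M) ℝ} (hS : S.PosDef) {σsq : Fin M → ℝ} (hσ : ∀ m, 0 < σsq m)
    {U : Matrix (Fin M) (Fin M) ℝ} (hU : U ∈ Matrix.orthogonalGroup (Fin M) ℝ)
    (hSU : S = U * Matrix.diagonal σsq * U.transpose) (hR : IsAchievable S Γ Λ R) :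
    R ≤ waterRate (jammedSpectrum σsq Λ) Γ := by
  have hτ : ∀ m, 0 < jammedSpectrum σsq Λ m := by
    intro m
    have := hσ m
    unfold jammedSpectrum
    split_ifs <;> positivity
  rw [waterRate_eq hτ]
  -- For `Λ = 0` there is no room below `Λ`, and `l = 0` is exact. Otherwise the bound for `l < Λ`
  -- passes to the limit by continuity in `l`.
  rcases hΛ.eq_or_lt with rfl | hΛ'
  · exact hR.le_sum_log hM hΓ hS hσ hU hSU le_rfl (Or.inr ⟨rfl, rfl⟩)
  set γ := waterLevel (jammedSpectrum σsq Λ) Γ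
  have hγ : 0 < γ := waterLevel_pos hM hΓ hτ
  have hcont : Tendsto (fun l => ∑ m, 1 / 2 * Real.log (max γ (jammedSpectrum σsq Λ m) /
      jammedSpectrum σsq l m)) (𝓝[<] Λ)
      (𝓝 (∑ m, 1 / 2 * Real.log (max γ (jammedSpectrum σsq Λ m) / jammedSpectrum σsq Λ m))) := by
    refine tendsto_nhdsWithin_of_tendsto_nhds (tendsto_finsetSum _ fun m _ => ?_)
    have hj : Tendsto (fun l => jammedSpectrum σsq l m) (𝓝 Λ) (𝓝 (jammedSpectrum σsq Λ m)) := by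
      unfold jammedSpectrum
      split_ifs
      · exact tendsto_id.const_add _
      · exact tendsto_const_nhds
    have hpos : max γ (jammedSpectrum σsq Λ m) / jammedSpectrum σsq Λ m ≠ 0 :=
      (div_pos (hγ.trans_le (le_max_left _ _)) (hτ m)).ne'
    exact (((tendsto_const_nhds.div hj (hτ m).ne').log hpos).const_mul _)
  refine ge_of_tendsto hcont ?_
  filter_upwards [Ioo_mem_nhdsLT hΛ'] with l hl
  exact hR.le_sum_log hM hΓ hS hσ hU hSU hl.1.le (Or.inl hl.2)

theorem eigenvalue_pos {M : ℕ} {S : Matrix (Fin M) (Fin M) ℝ} (hS : S.PosDef) {σsq : Fin M → ℝ}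
    {U : Matrix (Fin M) (Fin M) ℝ} (hU : U ∈ Matrix.orthogonalGroup (Fin M) ℝ)
    (hSU : S = U * Matrix.diagonal σsq * U.transpose) (m : Fin M) : 0 < σsq m := by
  have hUU : Uᵀ * U = 1 := (Matrix.mem_orthogonalGroup_iff' (Fin M) ℝ).1 hU
  have hne : U *ᵥ Pi.single m 1 ≠ 0 := by
    intro h
    have h2 := congrArg (Uᵀ *ᵥ ·) h
    simp only [Matrix.mulVec_mulVec, hUU, Matrix.one_mulVec, Matrix.mulVec_zero] at h2
    simpa using congrFun h2 m
  have h := hS.dotProduct_mulVec_pos hne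
  rw [star_trivial, hSU, Matrix.mulVec_mulVec, Matrix.mul_assoc, hUU, Matrix.mul_one,
    ← Matrix.mulVec_mulVec, Matrix.dotProduct_mulVec, Matrix.vecMul_mulVec, hUU] at h
  simpa using h

end MimoAVC

end

theorem mainTheorem9 (M : ℕ) (hM : 0 < M) (Γ Λ : ℝ) (hΓ : 0 ≤ Γ) (hΛ : 0 ≤ Λ)
    -- the noise covariance matrix and its eigenvalues `σsq`, sorted increasingly
    (S : Matrix (Fin M) (Fin M) ℝ) (hS : S.PosDef)
    (σsq : Fin M → ℝ) (hσ : Monotone σsq)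
    (U : Matrix (Fin M) (Fin M) ℝ) (hU : U ∈ Matrix.orthogonalGroup (Fin M) ℝ)
    (hSU : S = U * Matrix.diagonal σsq * U.transpose) :
    -- the maximum that defines the water level is attained
    IsGreatest (MimoAVC.feasibleLevels (MimoAVC.jammedSpectrum σsq Λ) Γ)
        (MimoAVC.waterLevel (MimoAVC.jammedSpectrum σsq Λ) Γ) ∧
      MimoAVC.capacity S Γ Λ ≤
        ((MimoAVC.waterRate (MimoAVC.jammedSpectrum σsq Λ) Γ : ℝ) : EReal) := by
  refine ⟨MimoAVC.isGreatest_waterLevel hM hΓ, sSup_le ?_⟩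
  rintro _ ⟨R, hR, rfl⟩
  exact EReal.coe_le_coe_iff.2 (MimoAVC.IsAchievable.le_waterRate hM hΓ hΛ hS
    (MimoAVC.eigenvalue_pos hS hU hSU) hU hSU hR)
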